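/- For a square matrix $A=[a_{j,k}]_{1\le j,k\le m}$ over a field let $\operatorname{per}(A)=\sum_{\tau\in S_m}\prod_{j=1}^m a_{j,\tau(j)}$ be its permanent. (i) Let $n$ be a positive integer and let $x_1,\dots,x_{2n}$ be pairwise distinct elements of a field $K$ (for example, independent variables in a field of rational functions). Put $x_{j,k}=\dfrac{x_j+x_k}{x_j-x_k}$ for $j\ne k$ and $x_{j,j}=1$, and let $S(x_1,\dots,x_{2n})=\operatorname{per}[x_{j,k}]_{1\le j,k\le 2n}$. Then $$\operatorname{per}[x_{j,k}-1]_{1\le j,k\le 2n}=(-1)^n\det[x_{j,k}-1]_{1\le j,k\le 2n}=S(x_1,\dots,x_{2n}).$$ (ii) Let $n>1$ be an integer and let $\zeta$ be a primitive $n$-th root of unity in a field $K$ (for example $K=\mathbb C$). Put $c_{j,k}=\dfrac{1+\zeta^{j-k}}{1-\zeta^{j-k}}$ for $j\ne k$ and $c_{j,j}=1$. If $n$ is even, then $$\operatorname{per}[c_{j,k}]_{1\le j,k\le n}=((n-1)!!)^2.$$ If $n$ is odd, then $$\operatorname{per}[c_{j,k}]_{1\le j,k\le n-1}=\frac{((n-1)!!)^2}{n}.$$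 -/

import Mathlib

/-- The numbers `x_{j,k}`: `(x_j + x_k) / (x_j - x_k)` off the diagonal and `1` on it. They are
meant for pairwise distinct `x_j`; for example `x` may be the family of independent variables in a
field of rational functions. -/
def xEntry {K : Type*} [Field K] {m : ℕ} (x : Fin m → K) (j k : Fin m) : K :=
  if j = k then 1 else (x j + x k) / (x j - x k)

/-- `S(x_1, …, x_m)`, the permanent of the matrix `[x_{j,k}]`. -/
def permS {K : Type*} [Field K] {m : ℕ} (x : Fin m → K) : K :=
  (Matrix.of fun j k => xEntry x j k).permanent

/-- The `m × m` matrix `[c_{j,k}]` with `c_{j,k} = (1 + ζ^(j-k)) / (1 - ζ^(j-k))` off the diagonal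
and `1` on it. The exponent is an integer, and as only `j - k` matters, the indices
`0, …, m - 1` serve as well as `1, …, m`. -/
def cMatrix {K : Type*} [Field K] (ζ : K) (m : ℕ) : Matrix (Fin m) (Fin m) K :=
  Matrix.of fun j k =>
    if j = k then 1
    else (1 + ζ ^ ((j : ℤ) - (k : ℤ))) / (1 - ζ ^ ((j : ℤ) - (k : ℤ)))

/-!
The matrix `[x_{j,k} + t]` is studied for a common shift `t` of all entries, and its permanent is
computed by inserting one point `v` into the permutations of the others. The entries satisfy the
addition theorem of the hyperbolic cotangent,
`(x_{i,v} + t)(x_{v,j} + t) = (t² - 1) + (x_{i,j} + t)(x_{i,v} - x_{j,v})`, with the additional term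
`w(x_i, x_v) = -4 x_i x_v / (x_i - x_v)²` for `i = j`. The difference terms telescope along cycles
(`characterPermanent_option`). What remains is a recursion in the number of points,
`P(I) = (1 + t) P(I \ v) + ∑ i, w(x_i, x_v) P(I \ {i, v}) + (t² - 1) P'(I \ v)`.

At `t = -1` only the transpositions are left, both for permanents and for determinants, so that the
permanent and the determinant of `[x_{j,k} - 1]` differ by one sign per transposition
(`permanent_offMatrix_eq_det`). For general `t` the recursion shows that `P(t) = P(-1) + (1 + t) Q(t)`
with `Q` even or odd (`exists_shiftedPermanent_eq`). For an even number of points `Q` is odd, hence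
`P(0) = P(-1)`, which is the equality with `S` (`permS_eq`).

For the points `ζ⁻¹ ^ j` the permanent thereby becomes, up to a sign, the determinant of a circulant
matrix with zero diagonal, or for odd `n` a principal minor of it. The Fourier matrix diagonalizes it
with the eigenvalues `n - 1, n - 3, …, -(n - 1)` (`offMatrix_mul_dftMatrix`). Their product gives the
even case. For odd `n` one eigenvalue is zero, all principal minors of order `n - 1` are equal, and
their sum is the product of the nonzero eigenvalues (`adjugate_offMatrix_invPow`).
-/

open Equiv Finset Polynomial

/-! ### Permanents and determinants by insertion of a point -/

/-- The sum over all permutations of the products of matrix entries, weighted by `χ (sign σ)`. It is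
the permanent if `χ` is trivial and the determinant if `χ` is the identity, so that recursions for
both are proved at once. -/
def characterPermanent {ι R : Type*} [Fintype ι] [DecidableEq ι] [CommRing R] (χ : ℤˣ →* ℤˣ)
    (A : Matrix ι ι R) : R :=
  ∑ σ : Perm ι, ((χ (Perm.sign σ) : ℤ) : R) * ∏ i, A i (σ i)

section
variable {ι κ R : Type*} [Fintype ι] [DecidableEq ι] [Fintype κ] [DecidableEq κ] [CommRing R]

theorem characterPermanent_one (A : Matrix ι ι R) :
    characterPermanent 1 A = A.permanent := by
  rw [← Matrix.permanent_transpose]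
  simp [characterPermanent, Matrix.permanent]

theorem characterPermanent_id (A : Matrix ι ι R) :
    characterPermanent (MonoidHom.id _) A = A.det := by
  rw [← Matrix.det_transpose, Matrix.det_apply']
  simp [characterPermanent]

theorem characterPermanent_submatrix_equiv (χ : ℤˣ →* ℤˣ) (e : κ ≃ ι) (A : Matrix ι ι R) :
    characterPermanent χ (A.submatrix e e) = characterPermanent χ A := by
  unfold characterPermanent
  refine Fintype.sum_equiv e.permCongr _ _ fun σ => ?_
  rw [Perm.sign_permCongr, ← e.prod_comp]
  simp [Equiv.permCongr_apply]

theorem map_characterPermanent {S : Type*} [CommRing S] (χ : ℤˣ →* ℤˣ) (f : R →+* S)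
    (A : Matrix ι ι R) : f (characterPermanent χ A) = characterPermanent χ (A.map f) := by
  simp [characterPermanent]

/-- The permutations fixing a point contribute the matrix with the row and column of that point
removed; its diagonal entry does not enter. -/
theorem sum_perm_option_fixing_none (χ : ℤˣ →* ℤˣ) (A : Matrix (Option ι) (Option ι) R) :
    (∑ σ : Perm (Option ι), if σ none = none then
      ((χ (Perm.sign σ) : ℤ) : R) * ∏ j ∈ univ.erase none, A j (σ j) else 0) =
      characterPermanent χ (A.submatrix some some) := by
  rw [← Perm.decomposeOption.symm.sum_comp, Fintype.sum_prod_type, Fintype.sum_option]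
  have h : (univ : Finset (Option ι)).erase none = univ.map Function.Embedding.some := by
    ext x; cases x <;> simp
  simp [characterPermanent, Perm.decomposeOption_symm_apply, h]

/-- The version of `sum_perm_option_fixing_none` for a point of `Fin (m + 1)`. -/
theorem sum_perm_fixing (χ : ℤˣ →* ℤˣ) {m : ℕ} (A : Matrix (Fin (m + 1)) (Fin (m + 1)) R)
    (i : Fin (m + 1)) :
    (∑ σ : Perm (Fin (m + 1)), if σ i = i then
      ((χ (Perm.sign σ) : ℤ) : R) * ∏ j ∈ univ.erase i, A j (σ j) else 0) =
      characterPermanent χ (A.submatrix i.succAbove i.succAbove) := by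
  set e := finSuccEquiv' i
  have h := sum_perm_option_fixing_none χ (A.submatrix e.symm e.symm)
  have h2 : (A.submatrix e.symm e.symm).submatrix some some =
      A.submatrix i.succAbove i.succAbove := by
    ext a b; simp [e]
  rw [h2] at h
  rw [← h]
  refine Fintype.sum_equiv e.permCongr _ _ fun σ => ?_
  have he : e.symm none = i := by simp [e]
  have h3 : e.permCongr σ none = none ↔ σ i = i := by
    rw [Equiv.permCongr_apply, he, ← e.symm.injective.eq_iff, he, Equiv.symm_apply_apply]
  simp only [h3, Perm.sign_permCongr]
  congr 2
  refine Finset.prod_equiv e (fun j => ?_) fun j _ => ?_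
  · simp [← he, Equiv.eq_symm_apply]
  · simp [Equiv.permCongr_apply]

/-- Insertion of the point `none` into the permutations of `ι`. Either `none` is a fixed point, or it
is inserted between some `i` and `σ i`; then the entry at `(i, σ i)` is replaced by
`A (some i) none * A none (some (σ i))`. Under the hypothesis `h` the terms with `g` telescope along
the cycles of `σ`, while the terms with `w` require `σ i = i`, so that `none` and `i` form a
transposition. -/
theorem characterPermanent_option (χ : ℤˣ →* ℤˣ) (A : Matrix (Option ι) (Option ι) R) (c : R)
    (g w : ι → R) (h : ∀ i j, A (some i) none * A none (some j) =
      c + A (some i) (some j) * (g i - g j) + if j = i then w i else 0) :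
    characterPermanent χ A = A none none * characterPermanent χ (A.submatrix some some) +
      ((χ (-1) : ℤ) : R) *
        ((∑ i, w i * ∑ σ : Perm ι, if σ i = i then
          ((χ (Perm.sign σ) : ℤ) : R) * ∏ j ∈ univ.erase i, A (some j) (some (σ j)) else 0) +
        c * ∑ σ : Perm ι, ((χ (Perm.sign σ) : ℤ) : R) *
          ∑ i, ∏ j ∈ univ.erase i, A (some j) (some (σ j))) := by
  unfold characterPermanent
  rw [← Perm.decomposeOption.symm.sum_comp, Fintype.sum_prod_type, Fintype.sum_option]
  congr 1
  · simp [Perm.decomposeOption_symm_apply, Finset.mul_sum, mul_left_comm]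
  · simp only [Finset.mul_sum]
    rw [Finset.sum_comm, Finset.sum_comm (γ := ι), ← Finset.sum_add_distrib, Finset.mul_sum]
    refine Finset.sum_congr rfl fun σ _ => ?_
    rw [← Equiv.sum_comp σ]
    have key : ∀ i, ∏ o, A o (Perm.decomposeOption.symm (some (σ i), σ) o) =
        (c + A (some i) (some (σ i)) * (g i - g (σ i)) + if σ i = i then w i else 0) *
          ∏ j ∈ univ.erase i, A (some j) (some (σ j)) := by
      intro i
      rw [Fintype.prod_option, ← h, ← Finset.mul_prod_erase univ _ (mem_univ i)]
      have : ∏ j ∈ univ.erase i, A (some j) (Perm.decomposeOption.symm (some (σ i), σ) (some j)) =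
          ∏ j ∈ univ.erase i, A (some j) (some (σ j)) := by
        refine Finset.prod_congr rfl fun j hj => ?_
        have hne : σ j ≠ σ i := fun hh => (Finset.ne_of_mem_erase hj) (σ.injective hh)
        simp [Perm.decomposeOption_symm_apply, Equiv.swap_apply_of_ne_of_ne, hne]
      rw [this]
      simp [Perm.decomposeOption_symm_apply]
      ring
    -- Each term of this sum is `g i - g (σ i)` times the whole product, and `σ` permutes the points.
    have tele : ∑ i, A (some i) (some (σ i)) * (g i - g (σ i)) *
        ∏ j ∈ univ.erase i, A (some j) (some (σ j)) = 0 := by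
      have : ∀ i, A (some i) (some (σ i)) * (g i - g (σ i)) *
        ∏ j ∈ univ.erase i, A (some j) (some (σ j)) =
          (g i - g (σ i)) * ∏ j, A (some j) (some (σ j)) := by
        intro i
        rw [← Finset.mul_prod_erase univ _ (mem_univ i)]
        ring
      rw [Finset.sum_congr rfl fun i _ => this i, ← Finset.sum_mul, Finset.sum_sub_distrib,
        Equiv.sum_comp σ g, sub_self, zero_mul]
    have hs : ∀ i, Perm.sign (Perm.decomposeOption.symm (some (σ i), σ)) = -1 * Perm.sign σ := by
      intro i
      simp [Perm.decomposeOption_symm_apply]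
    simp only [key, hs, map_mul]
    push_cast
    rw [← Finset.mul_sum, mul_assoc]
    congr 1
    simp only [add_mul, Finset.sum_add_distrib, tele, add_zero]
    simp only [mul_add, Finset.mul_sum]
    rw [← Finset.sum_add_distrib, ← Finset.sum_add_distrib]
    refine Finset.sum_congr rfl fun i _ => ?_
    split_ifs <;> ring
end

theorem characterPermanent_fin_add_two {R : Type*} [CommRing R] (χ : ℤˣ →* ℤˣ) {m : ℕ}
    (A : Matrix (Fin (m + 2)) (Fin (m + 2)) R) (c : R) (g w : Fin (m + 1) → R)
    (h : ∀ i j, A i.succ 0 * A 0 j.succ =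
      c + A i.succ j.succ * (g i - g j) + if j = i then w i else 0) :
    characterPermanent χ A = A 0 0 * characterPermanent χ (A.submatrix Fin.succ Fin.succ) +
      ((χ (-1) : ℤ) : R) *
        ((∑ i, w i * characterPermanent χ
          ((A.submatrix Fin.succ Fin.succ).submatrix i.succAbove i.succAbove)) +
        c * ∑ σ : Perm (Fin (m + 1)), ((χ (Perm.sign σ) : ℤ) : R) *
          ∑ i, ∏ j ∈ univ.erase i, A j.succ (σ j).succ) := by
  rw [← characterPermanent_submatrix_equiv χ (finSuccEquiv (m + 1)).symm A,
    characterPermanent_option χ _ c g w (by simpa using h)]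
  have h2 : (A.submatrix (finSuccEquiv (m + 1)).symm (finSuccEquiv (m + 1)).symm).submatrix
      some some = A.submatrix Fin.succ Fin.succ := by
    ext a b; simp
  rw [h2]
  simp only [← sum_perm_fixing]
  simp

section
variable {K : Type*} [Field K]

/-! ### The entries `x_{j,k}` -/

theorem xEntry_self {m : ℕ} (x : Fin m → K) (i : Fin m) : xEntry x i i = 1 := by
  simp [xEntry]

theorem xEntry_comp {m k : ℕ} (x : Fin m → K) {f : Fin k → Fin m} (hf : Function.Injective f)
    (i j : Fin k) : xEntry x (f i) (f j) = xEntry (x ∘ f) i j := by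
  simp [xEntry, hf.eq_iff]

/-- The weight `w(a, b) = -4ab / (a - b)²` of a transposition. It equals
`1 - ((a + b) / (a - b))²`. -/
def pairWeight (a b : K) : K := -(4 * a * b / (a - b) ^ 2)

/-- The addition theorem of the hyperbolic cotangent, `x_{j,k}` being `coth ((u_j - u_k) / 2)` for
`x_j = exp u_j`; for `i = j` it leaves the double pole `pairWeight`. -/
theorem xEntry_mul_xEntry {m : ℕ} {x : Fin m → K} (hx : Function.Injective x) {i j v : Fin m}
    (hi : i ≠ v) (hj : j ≠ v) (t : K) :
    (xEntry x i v + t) * (xEntry x v j + t) = (t ^ 2 - 1) +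
      (xEntry x i j + t) * (xEntry x i v - xEntry x j v) +
      if j = i then pairWeight (x i) (x v) else 0 := by
  have h1 : x i - x v ≠ 0 := sub_ne_zero.2 (hx.ne hi)
  have h2 : x j - x v ≠ 0 := sub_ne_zero.2 (hx.ne hj)
  have h2' : x v - x j ≠ 0 := sub_ne_zero.2 (hx.ne hj.symm)
  rcases eq_or_ne j i with rfl | hij
  · simp only [xEntry, hj, hj.symm, if_true, if_false, pairWeight]
    rw [show x v - x j = -(x j - x v) by ring]
    field_simp
    ring
  · have h3 : x i - x j ≠ 0 := sub_ne_zero.2 (hx.ne hij.symm)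
    simp only [xEntry, hi, hj.symm, hj, hij, hij.symm, if_false]
    rw [show x v - x j = -(x j - x v) by ring]
    field_simp
    ring

/-! ### The permanent with shifted entries -/

/-- The matrix with entries `x_{j,k} + X`, where the polynomial variable `X` is a common shift of all
entries, the diagonal ones included. -/
noncomputable def shiftedMatrix {m : ℕ} (x : Fin m → K) : Matrix (Fin m) (Fin m) K[X] :=
  Matrix.of fun j k => C (xEntry x j k) + X

theorem xEntry_mul_xEntry_polynomial {m : ℕ} {x : Fin m → K} (hx : Function.Injective x)
    {i j v : Fin m} (hi : i ≠ v) (hj : j ≠ v) :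
    shiftedMatrix x i v * shiftedMatrix x v j = (X ^ 2 - 1) +
      shiftedMatrix x i j * (C (xEntry x i v) - C (xEntry x j v)) +
      if j = i then C (pairWeight (x i) (x v)) else 0 := by
  have h0 := xEntry_mul_xEntry hx hi hj 0
  have h1 : xEntry x i v + xEntry x v j = xEntry x i v - xEntry x j v := by
    simp only [xEntry, hj, hj.symm, if_false]
    rw [show x v - x j = -(x j - x v) by ring, div_neg, add_comm (x v)]
    ring
  have h2 : (if j = i then C (pairWeight (x i) (x v)) else 0 : K[X]) =
      C (if j = i then pairWeight (x i) (x v) else 0) := by split_ifs <;> simp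
  have h3 := congrArg C h0
  have h4 := congrArg C h1
  simp only [shiftedMatrix, Matrix.of_apply, h2]
  simp only [map_add, map_mul, map_sub, map_pow, map_zero, map_one] at h3 h4
  linear_combination h3 + X * h4

/-- The permanent of `[x_{j,k} + X]`, a polynomial in the shift `X`. -/
noncomputable def shiftedPermanent {m : ℕ} (x : Fin m → K) : K[X] :=
  characterPermanent 1 (shiftedMatrix x)

/-- The sum over cofactors in `characterPermanent_fin_add_two` is the derivative in the shift variable,
because every entry has derivative `1`. -/
theorem shiftedPermanent_add_two {m : ℕ} {x : Fin (m + 2) → K} (hx : Function.Injective x) :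
    shiftedPermanent x = (1 + X) * shiftedPermanent (x ∘ Fin.succ) +
      ∑ i : Fin (m + 1), C (pairWeight (x i.succ) (x 0)) *
        shiftedPermanent ((x ∘ Fin.succ) ∘ i.succAbove) +
      (X ^ 2 - 1) * derivative (shiftedPermanent (x ∘ Fin.succ)) := by
  have hs : (shiftedMatrix x).submatrix Fin.succ Fin.succ = shiftedMatrix (x ∘ Fin.succ) := by
    ext1 a b
    simp [shiftedMatrix, xEntry_comp x (Fin.succ_injective _)]
  have hs2 : ∀ i : Fin (m + 1), (shiftedMatrix (x ∘ Fin.succ)).submatrix i.succAbove i.succAbove =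
      shiftedMatrix ((x ∘ Fin.succ) ∘ i.succAbove) := by
    intro i
    ext1 a b
    simp [shiftedMatrix, xEntry_comp (x ∘ Fin.succ) (Fin.succAbove_right_injective (p := i))]
  unfold shiftedPermanent
  rw [characterPermanent_fin_add_two 1 (shiftedMatrix x) (X ^ 2 - 1)
    (fun i => C (xEntry x i.succ 0)) (fun i => C (pairWeight (x i.succ) (x 0)))
    (fun i j => by
      rw [xEntry_mul_xEntry_polynomial hx (Fin.succ_ne_zero i) (Fin.succ_ne_zero j)]
      simp only [Fin.succ_inj]), hs]
  simp only [hs2]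
  have hd : derivative (characterPermanent 1 (shiftedMatrix (x ∘ Fin.succ))) =
      ∑ σ : Perm (Fin (m + 1)), (((1 : ℤˣ →* ℤˣ) (Perm.sign σ) : ℤ) : K[X]) *
          ∑ i, ∏ j ∈ univ.erase i, shiftedMatrix x j.succ (σ j).succ := by
    simp [characterPermanent, derivative_prod_finset, ← hs]
    simp [shiftedMatrix]
  rw [hd]
  simp [shiftedMatrix, xEntry_self]
  ring

/-! ### The matrix with zero diagonal -/

/-- The matrix `[x_{j,k} - 1]`. Its diagonal is zero. -/
def offMatrix {m : ℕ} (x : Fin m → K) : Matrix (Fin m) (Fin m) K :=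
  Matrix.of fun j k => xEntry x j k - 1

/-- At the shift `-1` the factor `t ^ 2 - 1` and the diagonal vanish, and only the transpositions of the
first point with the other points remain. -/
theorem characterPermanent_offMatrix_add_two (χ : ℤˣ →* ℤˣ) {m : ℕ} {x : Fin (m + 2) → K}
    (hx : Function.Injective x) :
    characterPermanent χ (offMatrix x) = ((χ (-1) : ℤ) : K) *
      ∑ i : Fin (m + 1), pairWeight (x i.succ) (x 0) *
        characterPermanent χ (offMatrix ((x ∘ Fin.succ) ∘ i.succAbove)) := by
  rw [characterPermanent_fin_add_two χ (offMatrix x) 0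
    (fun i => xEntry x i.succ 0) (fun i => pairWeight (x i.succ) (x 0))
    (fun i j => by
      have := xEntry_mul_xEntry hx (Fin.succ_ne_zero i) (Fin.succ_ne_zero j) (-1)
      simpa [← sub_eq_add_neg, offMatrix] using this)]
  have h0 : offMatrix x 0 0 = 0 := by simp [offMatrix, xEntry_self]
  rw [h0, zero_mul, zero_mul, zero_add, add_zero]
  congr 1
  refine Finset.sum_congr rfl fun i _ => ?_
  congr 2
  ext1 a b
  have h1 := xEntry_comp x (Fin.succ_injective _) (i.succAbove a) (i.succAbove b)
  have h2 := xEntry_comp (x ∘ Fin.succ) (Fin.succAbove_right_injective (p := i)) a b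
  simp [offMatrix, h1, h2]

theorem injective_comp_succ_succAbove {α : Type*} {m : ℕ} {x : Fin (m + 2) → α}
    (hx : Function.Injective x) (i : Fin (m + 1)) : Function.Injective ((x ∘ Fin.succ) ∘ i.succAbove) :=
  (hx.comp (Fin.succ_injective _)).comp Fin.succAbove_right_injective

theorem characterPermanent_offMatrix_odd (χ : ℤˣ →* ℤˣ) : ∀ {m : ℕ}, Odd m → ∀ {x : Fin m → K},
    Function.Injective x → characterPermanent χ (offMatrix x) = 0
  | 0, hm, _, _ => by simp at hm
  | 1, _, x, _ => by simp [characterPermanent, offMatrix, xEntry_self]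
  | m + 2, hm, x, hx => by
    rw [characterPermanent_offMatrix_add_two χ hx]
    have hm' : Odd m := by rcases hm with ⟨k, hk⟩; exact ⟨k - 1, by omega⟩
    simp [characterPermanent_offMatrix_odd χ hm' (injective_comp_succ_succAbove hx _)]

theorem characterPermanent_offMatrix_even (χ : ℤˣ →* ℤˣ) (n : ℕ) {x : Fin (2 * n) → K}
    (hx : Function.Injective x) : characterPermanent χ (offMatrix x) =
      ((χ (-1) : ℤ) : K) ^ n * characterPermanent 1 (offMatrix x) := by
  induction n with
  | zero => simp [characterPermanent]
  | succ n ih =>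
    have h1 := characterPermanent_offMatrix_add_two χ (m := 2 * n) hx
    have h2 := characterPermanent_offMatrix_add_two 1 (m := 2 * n) hx
    have h3 : ∀ i : Fin (2 * n + 1), _ := fun i => ih (injective_comp_succ_succAbove hx i)
    refine h1.trans ?_
    refine Eq.trans ?_ (congrArg _ h2.symm)
    simp only [h3, Finset.mul_sum, MonoidHom.one_apply, Units.val_one, Int.cast_one, one_mul]
    refine Finset.sum_congr rfl fun i _ => ?_
    ring

/-! ### Parity of the permanent as a polynomial in the shift -/

/-- The value of the shifted permanent at `-1` splits off, and the quotient of the rest by `1 + X` is an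
even or odd polynomial, of the parity opposite to that of the number of points. -/
theorem exists_shiftedPermanent_eq : ∀ (m : ℕ) {x : Fin m → K}, Function.Injective x →
    ∃ Q : K[X], shiftedPermanent x = C (characterPermanent 1 (offMatrix x)) + (1 + X) * Q ∧
      Q.comp (-X) = (-1) ^ (m + 1) * Q
  | 0, x, _ => ⟨0, by simp [shiftedPermanent, characterPermanent], by simp⟩
  | 1, x, _ => ⟨1, by simp [shiftedPermanent, characterPermanent, shiftedMatrix, offMatrix,
      xEntry_self], by simp⟩
  | m + 2, x, hx => by
    obtain ⟨Q₁, h₁, p₁⟩ :=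
      exists_shiftedPermanent_eq (m + 1) (hx.comp (Fin.succ_injective _))
    choose Q h p using fun i : Fin (m + 1) =>
      exists_shiftedPermanent_eq m (injective_comp_succ_succAbove hx i)
    set c := characterPermanent 1 (offMatrix (x ∘ Fin.succ)) with hc
    -- For an odd number of points the constant is zero, so it has either parity as needed.
    have hpar : C c = (-1) ^ (m + 1) * C c := by
      rcases Nat.even_or_odd (m + 1) with he | ho
      · simp [he.neg_one_pow]
      · rw [hc, characterPermanent_offMatrix_odd 1 ho (hx.comp (Fin.succ_injective _))]
        simp
    refine ⟨C c + ∑ i, C (pairWeight (x i.succ) (x 0)) * Q i + 2 * X * Q₁ +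
      (X ^ 2 - 1) * derivative Q₁, ?_, ?_⟩
    · rw [shiftedPermanent_add_two hx, characterPermanent_offMatrix_add_two 1 hx, h₁]
      simp only [h, mul_add, Finset.sum_add_distrib]
      simp only [MonoidHom.one_apply, Units.val_one, Int.cast_one, one_mul, map_sum, map_mul,
        derivative_add, derivative_mul, derivative_C, derivative_one, derivative_X,
        mul_left_comm _ (1 + X : K[X]), ← Finset.mul_sum]
      ring
    · have hd : (derivative Q₁).comp (-X) = (-1) ^ (m + 1) * derivative Q₁ := by
        have := congrArg derivative p₁
        rw [derivative_comp] at this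
        have e : ((-1 : K[X]) ^ (m + 1 + 1)) = C ((-1) ^ (m + 1 + 1)) := by simp
        rw [e, derivative_C_mul, ← e] at this
        simp only [derivative_neg, derivative_X] at this
        linear_combination -this
      simp only [add_comp, sub_comp, mul_comp, pow_comp, one_comp, X_comp, C_comp, hd, p₁, p,
        Polynomial.sum_comp, ofNat_comp, mul_left_comm _ ((-1) ^ (m + 1) : K[X]),
        ← Finset.mul_sum]
      linear_combination hpar

/-- Passing from the shift `0` to the shift `-1` does not change the permanent: the odd polynomial `Q`
of `exists_shiftedPermanent_eq` vanishes at `0`. -/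
theorem permS_eq {n : ℕ} (hn : 0 < n) {x : Fin (2 * n) → K} (hx : Function.Injective x) :
    permS x = characterPermanent 1 (offMatrix x) := by
  have hS : (shiftedPermanent x).eval 0 = permS x := by
    rw [shiftedPermanent, ← coe_evalRingHom, map_characterPermanent, characterPermanent_one,
      permS]
    congr 1
    ext1 a b
    simp [shiftedMatrix]
  obtain ⟨Q, h, p⟩ := exists_shiftedPermanent_eq (2 * n) hx
  -- In characteristic two oddness of `Q` says nothing, but then all `x_{j,k}` are `1`.
  by_cases h2 : (2 : K) = 0
  · have hx1 : ∀ j k, xEntry x j k = 1 := by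
      intro j k
      rcases eq_or_ne j k with rfl | hjk
      · exact xEntry_self x j
      · have h3 : x j - x k ≠ 0 := sub_ne_zero.2 (hx.ne hjk)
        rw [xEntry, if_neg hjk, div_eq_one_iff_eq h3]
        linear_combination x k * h2
    have hfac : (((2 * n).factorial : ℕ) : K) = 0 := by
      obtain ⟨c, hc⟩ := Nat.dvd_factorial two_pos (by omega : 2 ≤ 2 * n)
      rw [hc, Nat.cast_mul, Nat.cast_two, h2, zero_mul]
    have hne : Nonempty (Fin (2 * n)) := ⟨⟨0, by omega⟩⟩
    have h0 : offMatrix x = 0 := by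
      ext1 j k
      simp [offMatrix, hx1]
    rw [h0, characterPermanent_one, Matrix.permanent_zero, ← hfac]
    simp [permS, Matrix.permanent, hx1, Fintype.card_perm]
  · have hQ : Q.eval 0 = 0 := by
      have := congrArg (eval 0) p
      rw [(by simp : Odd (2 * n + 1)).neg_one_pow] at this
      simp [eval_comp] at this
      have h3 : 2 * Q.eval 0 = 0 := by linear_combination this
      exact (mul_eq_zero.1 h3).resolve_left h2
    rw [← hS, h]
    simp [hQ]

/-- Both sides satisfy the recursion over pairs of points, the signs differing by one factor `-1`
for each removed transposition. -/
theorem permanent_offMatrix_eq_det (n : ℕ) {x : Fin (2 * n) → K} (hx : Function.Injective x) :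
    (offMatrix x).permanent = (-1) ^ n * (offMatrix x).det := by
  rw [← characterPermanent_one, ← characterPermanent_id,
    characterPermanent_offMatrix_even (MonoidHom.id _) n hx, ← mul_assoc]
  simp [← mul_pow]

/-! ### Points at the powers of a root of unity -/

/-- The first `m` powers of `ζ⁻¹`, as a family of points. -/
def invPow (ζ : K) (m : ℕ) (j : Fin m) : K := ζ⁻¹ ^ (j : ℕ)

theorem invPow_injective {ζ : K} {n m : ℕ} (hζ : IsPrimitiveRoot ζ n) (hm : m ≤ n) :
    Function.Injective (invPow ζ m) := fun i j h =>
  Fin.ext (hζ.inv.pow_inj (i.2.trans_le hm) (j.2.trans_le hm) h)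

/-- With the points `ζ⁻¹ ^ j`, rather than `ζ ^ j`, the entries `x_{j,k}` are exactly `c_{j,k}`. -/
theorem xEntry_invPow {ζ : K} (h0 : ζ ≠ 0) (m : ℕ) (j k : Fin m) :
    xEntry (invPow ζ m) j k = cMatrix ζ m j k := by
  simp only [xEntry, cMatrix, Matrix.of_apply, invPow]
  split_ifs with h
  · rfl
  · rw [zpow_sub₀ h0, zpow_natCast, zpow_natCast, inv_pow, inv_pow]
    have h1 : ζ ^ (j : ℕ) ≠ 0 := pow_ne_zero _ h0
    have h2 : ζ ^ (k : ℕ) ≠ 0 := pow_ne_zero _ h0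
    rw [← mul_div_mul_left (_ + _) (_ - _) h1]
    congr 1 <;> field_simp

theorem sum_pow_fin_eq_zero {z : K} {n : ℕ} (hz : z ^ n = 1) (hz1 : z ≠ 1) :
    ∑ r : Fin n, z ^ ((r : ℕ) + 1) = 0 := by
  have h := mul_geom_sum z n
  rw [hz, sub_self] at h
  simp only [pow_succ, ← Finset.sum_mul]
  rw [Fin.sum_univ_eq_sum_range (fun r => z ^ r),
    (mul_eq_zero.1 h).resolve_left (sub_ne_zero.2 hz1),
    zero_mul]

/-! ### Diagonalization of the circulant matrix -/

variable {ζ : K} {n : ℕ}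

/-- The Fourier matrix `[ζ ^ (j (r + 1))]`. The exponents `1, …, n` are used instead of
`0, …, n - 1`, so that the eigenvalues of `offMatrix` along its columns form an arithmetic
progression without a jump. -/
def dftMatrix (ζ : K) (n : ℕ) : Matrix (Fin n) (Fin n) K :=
  Matrix.of fun j r => (ζ ^ (j : ℕ)) ^ ((r : ℕ) + 1)

/-- The matrix `[ζ ^ (-j (r + 1))]`, which is `n` times the inverse of `dftMatrix ζ n`. -/
def dftMatrixInv (ζ : K) (n : ℕ) : Matrix (Fin n) (Fin n) K :=
  Matrix.of fun r j => (ζ⁻¹ ^ (j : ℕ)) ^ ((r : ℕ) + 1)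

theorem dftMatrix_mul_dftMatrixInv (hζ : IsPrimitiveRoot ζ n) :
    dftMatrix ζ n * dftMatrixInv ζ n = (n : K) • 1 := by
  ext j k
  have hn : n ≠ 0 := by rintro rfl; exact j.elim0
  have h0 : ζ ≠ 0 := hζ.ne_zero hn
  simp only [Matrix.mul_apply, dftMatrix, dftMatrixInv, Matrix.of_apply, ← mul_pow]
  rcases eq_or_ne j k with rfl | hjk
  · simp [h0]
  · rw [sum_pow_fin_eq_zero]
    · simp [hjk]
    · rw [mul_pow, ← pow_mul, ← pow_mul, mul_comm _ n, mul_comm _ n, pow_mul, pow_mul, inv_pow,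
        hζ.pow_eq_one]
      simp
    · intro h
      apply hjk
      rw [inv_pow] at h
      exact Fin.ext (hζ.pow_inj j.2 k.2 (mul_inv_eq_one₀ (pow_ne_zero _ h0) |>.1 h))

theorem natCast_ne_zero_of_isPrimitiveRoot (hζ : IsPrimitiveRoot ζ n) (hn : 0 < n) :
    (n : K) ≠ 0 := by
  have : NeZero n := ⟨hn.ne'⟩
  exact hζ.neZero'.out

theorem det_dftMatrix_ne_zero (hζ : IsPrimitiveRoot ζ n) (hn : 0 < n) : (dftMatrix ζ n).det ≠ 0 := by
  intro h
  have := congrArg Matrix.det (dftMatrix_mul_dftMatrixInv hζ)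
  rw [Matrix.det_mul, h, zero_mul, Matrix.det_smul, Matrix.det_one, mul_one] at this
  exact pow_ne_zero _ (natCast_ne_zero_of_isPrimitiveRoot hζ hn) this.symm

/-- The entry of `offMatrix` at `j ≠ k` is `2 z / (1 - z)` with `z = ζ ^ (j - k)`, here with the
denominator cleared. -/
theorem offMatrix_invPow_apply (hζ : IsPrimitiveRoot ζ n) {j k : Fin n} (hjk : j ≠ k) :
    (1 - ζ ^ (j : ℕ) * ζ⁻¹ ^ (k : ℕ)) * offMatrix (invPow ζ n) j k =
      2 * (ζ ^ (j : ℕ) * ζ⁻¹ ^ (k : ℕ)) := by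
  have hn : n ≠ 0 := by rintro rfl; exact j.elim0
  have h0 : ζ ≠ 0 := hζ.ne_zero hn
  have h3 : ζ⁻¹ ^ (j : ℕ) - ζ⁻¹ ^ (k : ℕ) ≠ 0 :=
    sub_ne_zero.2 ((invPow_injective hζ le_rfl).ne hjk)
  have h4 : ζ ^ (j : ℕ) * ζ⁻¹ ^ (j : ℕ) = 1 := by rw [← mul_pow, mul_inv_cancel₀ h0, one_pow]
  simp only [offMatrix, xEntry, hjk, if_false, Matrix.of_apply, invPow]
  rw [show 1 - ζ ^ (j : ℕ) * ζ⁻¹ ^ (k : ℕ) =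
      ζ ^ (j : ℕ) * (ζ⁻¹ ^ (j : ℕ) - ζ⁻¹ ^ (k : ℕ)) by linear_combination -h4, div_sub_one h3,
    mul_assoc, mul_div_cancel₀ _ h3]
  ring

/-- The coefficient by which row `j` of the circulant matrix `offMatrix (invPow ζ n)` multiplies the
character `k ↦ ζ ^ (k r)`. It turns out not to depend on `j`. -/
def circulantEigenvalue (ζ : K) (n : ℕ) (j : Fin n) (r : ℕ) : K :=
  ∑ k, offMatrix (invPow ζ n) j k * (ζ ^ (k : ℕ) * ζ⁻¹ ^ (j : ℕ)) ^ r

/-- Multiplying the entry `2 z / (1 - z)` by `1 - z⁻¹` cancels its denominator, so that consecutive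
eigenvalues differ by a geometric sum. -/
theorem circulantEigenvalue_sub_succ (hζ : IsPrimitiveRoot ζ n) (j : Fin n) {r : ℕ} (hr : 0 < r)
    (hrn : r < n) :
    circulantEigenvalue ζ n j r - circulantEigenvalue ζ n j (r + 1) = 2 := by
  have h0 : ζ ≠ 0 := hζ.ne_zero (by omega)
  unfold circulantEigenvalue
  rw [← Finset.sum_sub_distrib]
  have h1 : ∀ k, offMatrix (invPow ζ n) j k * (ζ ^ (k : ℕ) * ζ⁻¹ ^ (j : ℕ)) ^ r -
      offMatrix (invPow ζ n) j k * (ζ ^ (k : ℕ) * ζ⁻¹ ^ (j : ℕ)) ^ (r + 1) =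
      (if k = j then 2 else 0) - 2 * (ζ⁻¹ ^ (j : ℕ)) ^ r * (ζ ^ r) ^ (k : ℕ) := by
    intro k
    have e : (ζ ^ (k : ℕ) * ζ⁻¹ ^ (j : ℕ)) ^ r = (ζ⁻¹ ^ (j : ℕ)) ^ r * (ζ ^ r) ^ (k : ℕ) := by
      rw [mul_pow, mul_comm, ← pow_mul ζ, ← pow_mul ζ, mul_comm r]
    have hi : ∀ i : ℕ, ζ⁻¹ ^ i * ζ ^ i = 1 := fun i => by
      rw [← mul_pow, inv_mul_cancel₀ h0, one_pow]
    split_ifs with hk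
    · subst hk
      rw [mul_assoc, ← e]
      simp [offMatrix, xEntry_self, h0]
    · have h := offMatrix_invPow_apply hζ (Ne.symm hk)
      rw [pow_succ, mul_assoc 2, ← e]
      have h5 := hi j
      have h6 := hi k
      have h7 : (ζ ^ (k : ℕ) * ζ⁻¹ ^ (j : ℕ)) * (ζ ^ (j : ℕ) * ζ⁻¹ ^ (k : ℕ)) = 1 := by
        linear_combination h6 + ζ⁻¹ ^ (k : ℕ) * ζ ^ (k : ℕ) * h5
      generalize ζ ^ (k : ℕ) * ζ⁻¹ ^ (j : ℕ) = u at *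
      generalize ζ ^ (j : ℕ) * ζ⁻¹ ^ (k : ℕ) = v at *
      linear_combination (-u * u ^ r) * h + (-2 * u ^ r - offMatrix (invPow ζ n) j k * u ^ r) * h7
  rw [Finset.sum_congr rfl fun k _ => h1 k, Finset.sum_sub_distrib, ← Finset.mul_sum,
    Fin.sum_univ_eq_sum_range (fun k => (ζ ^ r) ^ k)]
  have hz : ζ ^ r ≠ 1 := hζ.pow_ne_one_of_pos_of_lt hr.ne' hrn
  have h2 := mul_geom_sum (ζ ^ r) n
  rw [← pow_mul, mul_comm r, pow_mul, hζ.pow_eq_one, one_pow, sub_self] at h2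
  rw [(mul_eq_zero.1 h2).resolve_left (sub_ne_zero.2 hz)]
  simp

/-- The sum of the eigenvalues vanishes because the diagonal of the circulant matrix does. -/
theorem sum_circulantEigenvalue (hζ : IsPrimitiveRoot ζ n) (j : Fin n) :
    ∑ r : Fin n, circulantEigenvalue ζ n j (r + 1) = 0 := by
  have hn : n ≠ 0 := by rintro rfl; exact j.elim0
  have h0 : ζ ≠ 0 := hζ.ne_zero hn
  unfold circulantEigenvalue
  rw [Finset.sum_comm]
  refine Finset.sum_eq_zero fun k _ => ?_
  rw [← Finset.mul_sum]
  rcases eq_or_ne j k with rfl | hjk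
  · simp [offMatrix, xEntry_self]
  · have := congrFun (congrFun (dftMatrix_mul_dftMatrixInv hζ) k) j
    simp only [Matrix.mul_apply, dftMatrix, dftMatrixInv, Matrix.of_apply, ← mul_pow] at this
    rw [this]
    simp [hjk.symm]

/-- The eigenvalues form an arithmetic progression of difference `-2` and sum zero. -/
theorem circulantEigenvalue_eq (hζ : IsPrimitiveRoot ζ n) (j : Fin n) (r : Fin n) :
    circulantEigenvalue ζ n j (r + 1) = (n : K) - 1 - 2 * (r : ℕ) := by
  have hn : 0 < n := j.pos
  have h1 : ∀ r : ℕ, r < n →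
      circulantEigenvalue ζ n j (r + 1) = circulantEigenvalue ζ n j 1 - 2 * (r : K) := by
    intro r
    induction r with
    | zero => simp
    | succ r ih =>
      intro hr
      have := circulantEigenvalue_sub_succ hζ j (Nat.succ_pos r) hr
      rw [ih (by omega)] at this
      push_cast
      linear_combination -this
  have h2 := sum_circulantEigenvalue hζ j
  rw [Finset.sum_congr rfl fun (r : Fin n) _ => h1 r r.2, Finset.sum_sub_distrib, ← Finset.mul_sum,
    Fin.sum_univ_eq_sum_range (fun k => (k : K)), ← Nat.cast_sum] at h2
  have h3 : (((∑ i ∈ range n, i) * 2 : ℕ) : K) = ((n * (n - 1) : ℕ) : K) := by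
    rw [Finset.sum_range_id_mul_two]
  push_cast [Nat.cast_sub hn] at h3
  simp only [sum_const, card_univ, Fintype.card_fin, nsmul_eq_mul, Nat.cast_sum] at h2
  have h4 : (n : K) * (circulantEigenvalue ζ n j 1 - (n - 1)) = 0 := by
    linear_combination h2 + h3
  rw [h1 r r.2]
  linear_combination
    (mul_eq_zero.1 h4).resolve_left (natCast_ne_zero_of_isPrimitiveRoot hζ hn)

/-- The eigenvalues `n - 1, n - 3, …, -(n - 1)` of `offMatrix (invPow ζ n)`. -/
def offEigenvalue (K : Type*) [Field K] (n : ℕ) (r : Fin n) : K := (n : K) - 1 - 2 * (r : ℕ)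

theorem offMatrix_mul_dftMatrix (hζ : IsPrimitiveRoot ζ n) :
    offMatrix (invPow ζ n) * dftMatrix ζ n =
      dftMatrix ζ n * Matrix.diagonal (offEigenvalue K n) := by
  ext j r
  have hn : n ≠ 0 := by rintro rfl; exact j.elim0
  have h0 : ζ ≠ 0 := hζ.ne_zero hn
  rw [Matrix.mul_diagonal, offEigenvalue, ← circulantEigenvalue_eq hζ j r, circulantEigenvalue,
    Matrix.mul_apply, Finset.mul_sum]
  refine Finset.sum_congr rfl fun k _ => ?_
  have h5 : ζ⁻¹ ^ (j : ℕ) * ζ ^ (j : ℕ) = 1 := by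
    rw [← mul_pow, inv_mul_cancel₀ h0, one_pow]
  simp only [dftMatrix, Matrix.of_apply]
  rw [mul_left_comm, ← mul_pow]
  congr 2
  linear_combination -(ζ ^ (k : ℕ)) * h5

theorem det_offMatrix_invPow (hζ : IsPrimitiveRoot ζ n) (hn : 0 < n) :
    (offMatrix (invPow ζ n)).det = ∏ r, offEigenvalue K n r := by
  have h := congrArg Matrix.det (offMatrix_mul_dftMatrix hζ)
  rw [Matrix.det_mul, Matrix.det_mul, Matrix.det_diagonal, mul_comm] at h
  exact mul_left_cancel₀ (det_dftMatrix_ne_zero hζ hn) h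

/-- All diagonal cofactors of the circulant matrix are equal, and their sum is the sum of the
products of all but one of the eigenvalues. -/
theorem adjugate_offMatrix_invPow (hζ : IsPrimitiveRoot ζ n) (j : Fin n) :
    (n : K) * (offMatrix (invPow ζ n)).adjugate j j =
      ∑ r, ∏ s ∈ univ.erase r, offEigenvalue K n s := by
  have h0 : ζ ≠ 0 := hζ.ne_zero j.pos.ne'
  set M := offMatrix (invPow ζ n)
  set V := dftMatrix ζ n
  have h1 : M.adjugate * V = V * (Matrix.diagonal (offEigenvalue K n)).adjugate := by
    have h : V.adjugate * M.adjugate =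
        (Matrix.diagonal (offEigenvalue K n)).adjugate * V.adjugate := by
      rw [← Matrix.adjugate_mul_distrib, ← Matrix.adjugate_mul_distrib, offMatrix_mul_dftMatrix hζ]
    refine smul_right_injective _ (det_dftMatrix_ne_zero hζ j.pos) ?_
    calc V.det • (M.adjugate * V) = V * (V.adjugate * M.adjugate) * V := by
          rw [← Matrix.mul_assoc V, Matrix.mul_adjugate, Matrix.smul_mul, Matrix.one_mul,
            Matrix.smul_mul]
      _ = V.det • (V * (Matrix.diagonal (offEigenvalue K n)).adjugate) := by
          rw [h, Matrix.mul_assoc, Matrix.mul_assoc _ _ V, Matrix.adjugate_mul, Matrix.mul_smul,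
            Matrix.mul_one, Matrix.mul_smul]
  have h2 := congrArg (fun B => (B * dftMatrixInv ζ n) j j) h1
  simp only [Matrix.mul_assoc, V, dftMatrix_mul_dftMatrixInv hζ, Matrix.adjugate_diagonal] at h2
  rw [Matrix.mul_smul, Matrix.mul_one, Matrix.smul_apply, smul_eq_mul, Matrix.mul_apply] at h2
  rw [h2]
  refine Finset.sum_congr rfl fun r _ => ?_
  rw [Matrix.diagonal_mul, mul_left_comm]
  have : dftMatrix ζ n j r * dftMatrixInv ζ n r j = 1 := by
    simp [dftMatrix, dftMatrixInv, h0]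
  rw [this, mul_one]

/-! ### Products of the eigenvalues -/

/-- For `n = 2 k` the eigenvalues are the odd numbers from `-(n - 1)` to `n - 1`. -/
theorem prod_offEigenvalue_two_mul (k : ℕ) (hk : 0 < k) :
    ∏ r, offEigenvalue K (2 * k) r = (-1) ^ k * ((2 * k - 1).doubleFactorial : K) ^ 2 := by
  obtain ⟨k, rfl⟩ : ∃ l, k = l + 1 := ⟨k - 1, by omega⟩
  have h : ((2 * (k + 1) - 1).doubleFactorial : K) = ∏ i ∈ range (k + 1), (2 * (i : K) + 1) := by
    rw [show 2 * (k + 1) - 1 = 2 * k + 1 by omega, Nat.doubleFactorial_eq_prod_odd,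
      Finset.prod_range_succ']
    push_cast
    simp
  rw [h]
  unfold offEigenvalue
  rw [Fin.prod_univ_eq_prod_range (fun r => ((2 * (k + 1) : ℕ) : K) - 1 - 2 * (r : K)), two_mul,
    Finset.prod_range_add, sq, mul_left_comm, ← Finset.prod_range_reflect]
  congr 1
  · refine Finset.prod_congr rfl fun i hi => ?_
    have : i + 1 ≤ k + 1 := Finset.mem_range.1 hi
    rw [show k + 1 - 1 - i = k - i by omega, Nat.cast_sub (by omega)]
    push_cast
    ring
  · rw [← Finset.card_range (k + 1), ← Finset.prod_const, Finset.card_range,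
      ← Finset.prod_mul_distrib]
    refine Finset.prod_congr rfl fun i _ => ?_
    push_cast
    ring

/-- For `n = 2 k + 1` the eigenvalues are the even numbers from `-(n - 1)` to `n - 1`; only the term
that omits the eigenvalue `0` survives. -/
theorem sum_prod_erase_offEigenvalue (k : ℕ) :
    ∑ r, ∏ s ∈ univ.erase r, offEigenvalue K (2 * k + 1) s =
      (-1) ^ k * ((2 * k).doubleFactorial : K) ^ 2 := by
  set c : Fin (2 * k + 1) := ⟨k, by omega⟩ with hc
  have h0 : offEigenvalue K (2 * k + 1) c = 0 := by simp [offEigenvalue, hc]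
  rw [Finset.sum_eq_single c (fun r _ hr => Finset.prod_eq_zero
    (Finset.mem_erase.2 ⟨hr.symm, mem_univ c⟩) h0) (by simp)]
  set f : ℕ → K := fun r => ((2 * k + 1 : ℕ) : K) - 1 - 2 * (r : K) with hf
  have h1 : ∏ s ∈ univ.erase c, offEigenvalue K (2 * k + 1) s =
      ∏ r ∈ (range (2 * k + 1)).erase k, f r := by
    refine Finset.prod_bij (fun s _ => (s : ℕ)) ?_ ?_ ?_ ?_
    · intro s hs
      simp only [mem_erase, mem_univ, and_true, ne_eq, hc, Fin.ext_iff] at hs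
      simpa [hs] using Nat.le_of_lt_succ s.2
    · exact fun a _ b _ h => Fin.ext h
    · intro b hb
      simp only [mem_erase, mem_range] at hb
      exact ⟨⟨b, hb.2⟩, by simp [hc, Fin.ext_iff, hb.1], rfl⟩
    · intros; rfl
  have h2 : ∏ r ∈ (range (2 * k + 1)).erase k, f r =
      (∏ i ∈ range k, f i) * ∏ i ∈ range k, f (k + 1 + i) := by
    have : (range (2 * k + 1)).erase k = range k ∪ (range k).map (addLeftEmbedding (k + 1)) := by
      ext a
      simp only [mem_erase, mem_range, mem_union, mem_map, addLeftEmbedding_apply]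
      constructor
      · rintro ⟨h, h'⟩
        by_cases ha : a < k
        · exact Or.inl ha
        · exact Or.inr ⟨a - (k + 1), by omega, by omega⟩
      · rintro (h | ⟨b, hb, rfl⟩) <;> omega
    rw [this, Finset.prod_union, Finset.prod_map]
    · rfl
    · rw [Finset.disjoint_left]
      intro a ha
      simp only [mem_range, mem_map, addLeftEmbedding_apply, not_exists, not_and] at ha ⊢
      intro b _
      omega
  have h : ((2 * k).doubleFactorial : K) = ∏ i ∈ range k, (2 * ((i : K) + 1)) := by
    rw [Nat.doubleFactorial_eq_prod_even]
    push_cast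
    rfl
  rw [h1, h2, h, sq, mul_left_comm, ← Finset.prod_range_reflect]
  congr 1
  · refine Finset.prod_congr rfl fun i hi => ?_
    have : i + 1 ≤ k := Finset.mem_range.1 hi
    simp only [hf]
    rw [Nat.sub_sub, Nat.cast_sub (by omega)]
    push_cast
    ring
  · rw [← Finset.card_range k, ← Finset.prod_const, Finset.card_range,
      ← Finset.prod_mul_distrib]
    refine Finset.prod_congr rfl fun i _ => ?_
    simp only [hf]
    push_cast
    ring

/-! ### Evaluation of the permanents -/

theorem permanent_cMatrix_two_mul {m : ℕ} (hm : 0 < m) (hmn : 2 * m ≤ n)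
    (hζ : IsPrimitiveRoot ζ n) : (cMatrix ζ (2 * m)).permanent =
      (-1) ^ m * (offMatrix (invPow ζ (2 * m))).det := by
  have hinj := invPow_injective hζ hmn
  rw [← permanent_offMatrix_eq_det m hinj, ← characterPermanent_one (offMatrix _),
    ← permS_eq hm hinj, permS]
  congr 1
  ext1 j k
  exact (xEntry_invPow (hζ.ne_zero (by omega)) _ j k).symm
end

theorem theorem1p3 {K : Type*} [Field K] :
    (∀ n : ℕ, 0 < n → ∀ x : Fin (2 * n) → K, Function.Injective x →
      (Matrix.of fun j k => xEntry x j k - 1).permanent =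
          (-1) ^ n * (Matrix.of fun j k => xEntry x j k - 1).det ∧
      (-1) ^ n * (Matrix.of fun j k => xEntry x j k - 1).det = permS x) ∧
    (∀ n : ℕ, 1 < n → ∀ ζ : K, IsPrimitiveRoot ζ n →
      (Even n → (cMatrix ζ n).permanent = (Nat.doubleFactorial (n - 1) : K) ^ 2) ∧
      (Odd n → (cMatrix ζ (n - 1)).permanent =
        (Nat.doubleFactorial (n - 1) : K) ^ 2 / (n : K))) := by
  refine ⟨fun n hn x hx => ?_, fun n hn ζ hζ => ⟨fun he => ?_, fun ho => ?_⟩⟩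
  · have h := permanent_offMatrix_eq_det n hx
    refine ⟨h, ?_⟩
    rw [permS_eq hn hx, characterPermanent_one]
    exact h.symm
  · obtain ⟨k, rfl⟩ := he.two_dvd
    have hk : 0 < k := by omega
    rw [permanent_cMatrix_two_mul hk le_rfl hζ, det_offMatrix_invPow hζ (by omega),
      prod_offEigenvalue_two_mul k hk, ← mul_assoc, ← mul_pow]
    simp
  · obtain ⟨k, rfl⟩ := ho
    have hk : 0 < k := by omega
    rw [Nat.add_sub_cancel, permanent_cMatrix_two_mul hk (Nat.le_succ _) hζ,
      eq_div_iff (natCast_ne_zero_of_isPrimitiveRoot hζ (by omega))]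
    have h := adjugate_offMatrix_invPow hζ (Fin.last (2 * k))
    have hsub : (offMatrix (invPow ζ (2 * k + 1))).submatrix Fin.castSucc Fin.castSucc =
        offMatrix (invPow ζ (2 * k)) := by
      ext1 a b
      simp only [offMatrix, Matrix.submatrix_apply, Matrix.of_apply]
      rw [xEntry_comp _ (Fin.castSucc_injective _)]
      rfl
    -- The first `n - 1` points give the principal minor of the circulant matrix at the last index.
    rw [sum_prod_erase_offEigenvalue, Matrix.adjugate_fin_succ_eq_det_submatrix,
      Fin.succAbove_last, hsub, ← two_mul] at h
    rw [mul_assoc, mul_comm _ (((2 * k + 1 : ℕ) : K))]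
    simp only [pow_mul, neg_one_sq, one_pow, one_mul] at h
    rw [h, ← mul_assoc, ← mul_pow]
    simp
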